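/- Let $\mathcal H,\mathcal K$ be complex Hilbert spaces, let $J\subseteq\mathbb R$ be an interval and let $f:J\to\mathbb R$ be a convex function which is monotone (increasing or decreasing). Let $A_1,\dots,A_n\in\mathcal B(\mathcal H)$ be self-adjoint operators with spectra in $J$, and let $\Phi_1,\dots,\Phi_n:\mathcal B(\mathcal H)\to\mathcal B(\mathcal K)$ be positive linear maps with $\sum_{i=1}^n\Phi_i(\mathbf 1_{\mathcal H})=\mathbf 1_{\mathcal K}$. Let $s\mapsto C_s$ be a choice of slopes of supporting lines of $f$ on the spectra of the $A_i$, that is, for every $s\in\bigcup_{i}\mathrm{sp}(A_i)$, $C_s$ is a real number with $$C_s(t-s)+f(s)\le f(t)\qquad(t\in J).$$ (Such a number always exists when $s$ is an interior point of $J$; if an endpoint of $J$ lies in one of the spectra, its existence there is an assumption on $f$. The function $s\mapsto C_s$ is automatically increasing on the spectra, and $C_{A_i}$ denotes the operator obtained from $A_i$ and this bounded Borel function by the Borel functional calculus.) Then $f$ is continuous on the spectrum of every $A_i$, the spectrum of $\sum_{i=1}^n\Phi_i(A_i)$ is contained in $J$ and $f$ is continuous on it, the set $$S=\left\{\Big\langle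 \sum_{i=1}^n\Phi_i(C_{A_i}A_i)x,x\Big\rangle-\Big\langle\sum_{i=1}^n\Phi_i(A_i)x,x\Big\rangle\Big\langle\sum_{i=1}^n\Phi_i(C_{A_i})x,x\Big\rangle:\ x\in\mathcal K,\ \|x\|=1\right\}$$ is bounded above, and, with $\delta=\sup S$ (and $\delta=0$ if $\mathcal K=\{0\}$, where $S=\emptyset$), $$\sum_{i=1}^n\Phi_i(f(A_i))\le f\Big(\sum_{i=1}^n\Phi_i(A_i)\Big)+\delta\,\mathbf 1_{\mathcal K}.$$ -/

import Mathlib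

noncomputable section

namespace OperatorJensen

open MeasureTheory Filter Topology

variable {H : Type*} [NormedAddCommGroup H] [InnerProductSpace ℂ H] [CompleteSpace H]
  {A : H →L[ℂ] H}

lemma cfcHom_inner_re_nonneg (hA : IsSelfAdjoint A) (x : H) {h : C(spectrum ℝ A, ℝ)}
    (hh : 0 ≤ h) : 0 ≤ (inner ℂ (cfcHom (R := ℝ) hA h x) x).re := by
  have h1 : (0 : H →L[ℂ] H) ≤ cfcHom (R := ℝ) hA h := cfcHom_nonneg_iff hA |>.2 hh
  have h2 := (ContinuousLinearMap.nonneg_iff_isPositive _).1 h1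
  exact (Complex.le_def.1 (h2.inner_nonneg_left x)).1

/-- For a self-adjoint operator `A` and a vector `x`, the positive linear functional
`h ↦ ⟨h(A)x, x⟩` on the continuous functions on the (compact) real spectrum of `A`. -/
def spectralFunctional (hA : IsSelfAdjoint A) (x : H) :
    CompactlySupportedContinuousMap (spectrum ℝ A) ℝ →ₚ[ℝ] ℝ :=
  PositiveLinearMap.mk₀
    { toFun := fun h => (inner ℂ (cfcHom (R := ℝ) hA h.toContinuousMap x) x).re
      map_add' := fun h k => by
        have : (h + k).toContinuousMap = h.toContinuousMap + k.toContinuousMap := rfl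
        rw [this, map_add, add_apply, inner_add_left, Complex.add_re]
      map_smul' := fun c h => by
        have : (c • h).toContinuousMap = c • h.toContinuousMap := rfl
        rw [this, map_smul, smul_apply, inner_smul_left_eq_smul]
        simp }
    (fun h hh => cfcHom_inner_re_nonneg hA x (h := h.toContinuousMap) (fun s => hh s))

/-- The scalar spectral measure `μ_x` of a self-adjoint operator `A` at the vector `x`: the
measure on the spectrum with `∫ h dμ_x = ⟨h(A)x, x⟩` for continuous `h`. -/
def spectralMeasure (hA : IsSelfAdjoint A) (x : H) : Measure (spectrum ℝ A) :=
  RealRMK.rieszMeasure (spectralFunctional hA x)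

instance (hA : IsSelfAdjoint A) (x : H) : IsFiniteMeasure (spectralMeasure hA x) := by
  unfold spectralMeasure RealRMK.rieszMeasure
  infer_instance

lemma inner_cfcHom (hA : IsSelfAdjoint A) (x : H) (h : C(spectrum ℝ A, ℝ)) :
    inner ℂ (cfcHom (R := ℝ) hA h x) x = ((∫ s, h s ∂spectralMeasure hA x : ℝ) : ℂ) := by
  have h1 := RealRMK.integral_rieszMeasure (spectralFunctional hA x)
    (CompactlySupportedContinuousMap.continuousMapEquiv h)
  have h2 : ∫ s, h s ∂spectralMeasure hA x = (inner ℂ (cfcHom (R := ℝ) hA h x) x).re := h1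
  rw [h2]
  have h3 : IsSelfAdjoint (cfcHom (R := ℝ) hA h) := (IsSelfAdjoint.all h).map _
  exact (h3.isSymmetric.coe_re_inner_apply_self x).symm

/-- `T` is the operator `g(A)` in the sense of the Borel functional calculus:
`⟨T x, x⟩ = ∫ g dμ_x` for every vector `x`. -/
def IsBorelValue (hA : IsSelfAdjoint A) (g : spectrum ℝ A → ℝ) (T : H →L[ℂ] H) : Prop :=
  ∀ x : H, inner ℂ (T x) x = ((∫ s, g s ∂spectralMeasure hA x : ℝ) : ℂ)

/-- The Borel functional calculus `g(A)` of a self-adjoint operator `A`; only the restriction of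
`g` to the spectrum of `A` matters. For `g` bounded and measurable on the spectrum, `g(A)` is the
unique operator with `⟨g(A) x, x⟩ = ∫ g dμ_x` for all `x` (see `isBorelValue_borelCalculus` and
`IsBorelValue.eq`); in the other cases the value is irrelevant. -/
def borelCalculus (hA : IsSelfAdjoint A) (g : ℝ → ℝ) : H →L[ℂ] H :=
  open Classical in
  if h : ∃ T : H →L[ℂ] H, IsBorelValue hA (fun s => g s) T then h.choose else 0

theorem IsBorelValue.eq {hA : IsSelfAdjoint A} {g : spectrum ℝ A → ℝ} {S T : H →L[ℂ] H}
    (hS : IsBorelValue hA g S) (hT : IsBorelValue hA g T) : S = T := by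
  have : (S : H →ₗ[ℂ] H) = T :=
    (ext_inner_map _ _).1 fun x => (hS x).trans (hT x).symm
  exact ContinuousLinearMap.coe_injective this

lemma IsBorelValue.isSymmetric {hA : IsSelfAdjoint A} {g : spectrum ℝ A → ℝ} {T : H →L[ℂ] H}
    (hT : IsBorelValue hA g T) : (T : H →ₗ[ℂ] H).IsSymmetric := by
  rw [LinearMap.isSymmetric_iff_inner_map_self_real]
  intro v
  have := hT v
  simp only [ContinuousLinearMap.coe_coe, this, Complex.conj_ofReal]

lemma IsBorelValue.add {hA : IsSelfAdjoint A} {g k : spectrum ℝ A → ℝ} {S T : H →L[ℂ] H}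
    (hS : IsBorelValue hA g S) (hT : IsBorelValue hA k T)
    (hg : ∀ x, Integrable g (spectralMeasure hA x))
    (hk : ∀ x, Integrable k (spectralMeasure hA x)) :
    IsBorelValue hA (fun s => g s + k s) (S + T) := by
  intro x
  rw [integral_add (hg x) (hk x), add_apply, inner_add_left, hS x, hT x]
  push_cast
  rfl

lemma IsBorelValue.smul {hA : IsSelfAdjoint A} {g : spectrum ℝ A → ℝ} {T : H →L[ℂ] H}
    (hT : IsBorelValue hA g T) (c : ℝ) :
    IsBorelValue hA (fun s => c * g s) ((c : ℂ) • T) := by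
  intro x
  rw [integral_const_mul, smul_apply, inner_smul_left, hT x]
  simp

lemma integrable_of_bound (hA : IsSelfAdjoint A) (x : H) {g : spectrum ℝ A → ℝ}
    (hg : Measurable g) {M : ℝ} (hM : ∀ s, |g s| ≤ M) :
    Integrable g (spectralMeasure hA x) :=
  Integrable.of_bound hg.aestronglyMeasurable M (Eventually.of_forall hM)

lemma exists_of_tendsto_form {T : ℕ → H →L[ℂ] H}
    (hT : ∀ k, ((T k : H →L[ℂ] H) : H →ₗ[ℂ] H).IsSymmetric) (q : H → ℂ)
    (hq : ∀ x, Tendsto (fun k => inner ℂ (T k x) x) atTop (𝓝 (q x))) :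
    ∃ S : H →L[ℂ] H, ∀ x, inner ℂ (S x) x = q x := by
  have h1 : ∀ x y, ∃ b : ℂ, Tendsto (fun k => inner ℂ (T k x) y) atTop (𝓝 b) := by
    intro x y
    have := ((((hq (x + y)).sub (hq (x - y))).sub
      ((hq (x + Complex.I • y)).const_mul Complex.I)).add
      ((hq (x - Complex.I • y)).const_mul Complex.I)).div_const 4
    refine ⟨_, this.congr fun k => ?_⟩
    exact (inner_map_polarization' (T k : H →ₗ[ℂ] H) x y).symm
  choose B hB using h1
  let F : H → H →L[ℂ] ℂ := fun x => continuousLinearMapOfTendsto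
    (fun k => innerSL ℂ (T k x)) (f := B x) (tendsto_pi_nhds.2 fun y => hB x y)
  let v : H → H := fun x => (InnerProductSpace.toDual ℂ H).symm (F x)
  have hv : ∀ x y, inner ℂ (v x) y = B x y := fun x y =>
    InnerProductSpace.toDual_symm_apply
  let L : H →ₗ[ℂ] H :=
    { toFun := v
      map_add' := fun x y => by
        refine ext_inner_right ℂ fun z => ?_
        rw [inner_add_left, hv, hv, hv]
        refine tendsto_nhds_unique (hB (x + y) z) (((hB x z).add (hB y z)).congr fun k => ?_)
        rw [map_add, inner_add_left]
      map_smul' := fun c x => by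
        refine ext_inner_right ℂ fun z => ?_
        rw [RingHom.id_apply, inner_smul_left, hv, hv]
        refine tendsto_nhds_unique (hB (c • x) z) (((hB x z).const_mul _).congr fun k => ?_)
        rw [map_smul, inner_smul_left] }
  have hL : L.IsSymmetric := by
    intro x y
    change inner ℂ (v x) y = inner ℂ x (v y)
    rw [← inner_conj_symm x (v y), hv, hv]
    refine tendsto_nhds_unique (hB x y) (((hB y x).star).congr fun k => ?_)
    change (starRingEnd ℂ) _ = _
    rw [inner_conj_symm]
    exact (hT k x y).symm
  refine ⟨⟨L, hL.continuous⟩, fun x => ?_⟩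
  exact (hv x x).trans (tendsto_nhds_unique (hB x x) (hq x))

lemma exists_isBorelValue_of_tendsto (hA : IsSelfAdjoint A) {g : ℕ → spectrum ℝ A → ℝ}
    {g' : spectrum ℝ A → ℝ} (hg : ∀ k, Measurable (g k)) {M : ℝ} (hM : ∀ k s, |g k s| ≤ M)
    (hlim : ∀ s, Tendsto (fun k => g k s) atTop (𝓝 (g' s)))
    (hex : ∀ k, ∃ T, IsBorelValue hA (g k) T) : ∃ T, IsBorelValue hA g' T := by
  choose T hT using hex
  refine exists_of_tendsto_form (T := T) (fun k => (hT k).isSymmetric) _ fun x => ?_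
  simp_rw [hT _ x]
  refine (Complex.continuous_ofReal.tendsto _).comp ?_
  exact tendsto_integral_of_dominated_convergence (fun _ => M)
    (fun k => (hg k).aestronglyMeasurable) (integrable_const M)
    (fun k => Eventually.of_forall (hM k)) (Eventually.of_forall hlim)

lemma exists_isBorelValue_indicator (hA : IsSelfAdjoint A) {E : Set (spectrum ℝ A)}
    (hE : MeasurableSet E) : ∃ T, IsBorelValue hA (E.indicator fun _ => (1 : ℝ)) T := by
  have hb : ∀ (F : Set (spectrum ℝ A)) s, |F.indicator (fun _ => (1 : ℝ)) s| ≤ 1 := by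
    intro F s
    by_cases h : s ∈ F <;> simp [h]
  induction E, hE using MeasurableSpace.induction_on_inter
    (borel_eq_generateFrom_isClosed (α := spectrum ℝ A) ▸ BorelSpace.measurable_eq)
    isPiSystem_isClosed with
  | empty => exact ⟨0, fun x => by simp⟩
  | basic F hF =>
    have hF : IsClosed F := hF
    refine exists_isBorelValue_of_tendsto hA (g := fun n s => ((hF.apprSeq n s : NNReal) : ℝ))
      (M := 1) (fun n => ?_) (fun n s => ?_) (fun s => ?_) (fun n => ?_)
    · exact (NNReal.continuous_coe.comp (hF.apprSeq n).continuous).measurable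
    · rw [abs_of_nonneg (NNReal.coe_nonneg _)]
      exact_mod_cast HasOuterApproxClosed.apprSeq_apply_le_one hF n s
    · have h1 := (tendsto_pi_nhds.1 (HasOuterApproxClosed.tendsto_apprSeq hF)) s
      have h2 := (NNReal.continuous_coe.tendsto _).comp h1
      have h3 : ((F.indicator (fun _ => (1 : NNReal)) s : NNReal) : ℝ)
          = F.indicator (fun _ => (1 : ℝ)) s := by
        by_cases h : s ∈ F <;> simp [h]
      rw [← h3]
      exact h2
    · exact ⟨_, fun x => inner_cfcHom hA x
        ⟨_, NNReal.continuous_coe.comp (hF.apprSeq n).continuous⟩⟩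
  | compl E hE ih =>
    obtain ⟨T, hT⟩ := ih
    have h1 : IsBorelValue hA (fun _ => (1 : ℝ)) (cfcHom (R := ℝ) hA (ContinuousMap.const _ 1)) :=
      fun x => inner_cfcHom hA x (ContinuousMap.const _ 1)
    have h2 := h1.add (hT.smul (-1)) (fun x => integrable_const _)
      (fun x => (integrable_of_bound hA x (measurable_const.indicator hE) (hb E)).const_mul _)
    refine ⟨cfcHom (R := ℝ) hA (ContinuousMap.const _ 1) + ((-1 : ℝ) : ℂ) • T, ?_⟩
    convert h2 using 2 with s
    rename_i s
    by_cases h : s ∈ E <;> simp [h]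
  | iUnion f hd hf ih =>
    have hfin : ∀ n : ℕ, ∃ T, IsBorelValue hA
        ((⋃ i ∈ Finset.range n, f i).indicator fun _ => (1 : ℝ)) T := by
      intro n
      induction n with
      | zero => exact ⟨0, fun x => by simp⟩
      | succ n ihn =>
        obtain ⟨S, hS⟩ := ihn
        obtain ⟨T, hT⟩ := ih n
        have hm : MeasurableSet (⋃ i ∈ Finset.range n, f i) :=
          Finset.measurableSet_biUnion _ fun i _ => hf i
        have h2 := hS.add hT
          (fun x => integrable_of_bound hA x (measurable_const.indicator hm) (hb _))
          (fun x => integrable_of_bound hA x (measurable_const.indicator (hf n)) (hb _))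
        refine ⟨S + T, ?_⟩
        have hdis : Disjoint (⋃ i ∈ Finset.range n, f i) (f n) := by
          simp only [Set.disjoint_iUnion_left, Finset.mem_range]
          intro i hi
          exact hd hi.ne
        have h3 : (⋃ i ∈ Finset.range (n + 1), f i) = (⋃ i ∈ Finset.range n, f i) ∪ f n := by
          rw [Finset.range_add_one, Finset.set_biUnion_insert, Set.union_comm]
        rw [h3, Set.indicator_union_of_disjoint hdis]
        exact h2
    refine exists_isBorelValue_of_tendsto hA (M := 1) (fun n => ?_) (fun n s => hb _ s)
      (fun s => ?_) hfin
    · exact measurable_const.indicator (Finset.measurableSet_biUnion _ fun i _ => hf i)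
    · by_cases h : s ∈ ⋃ i, f i
      · obtain ⟨i, hi⟩ := Set.mem_iUnion.1 h
        refine tendsto_const_nhds.congr' ?_
        filter_upwards [eventually_gt_atTop i] with n hn
        have : s ∈ ⋃ i ∈ Finset.range n, f i :=
          Set.mem_biUnion (Finset.mem_coe.2 (Finset.mem_range.2 hn)) hi
        rw [Set.indicator_of_mem h, Set.indicator_of_mem this]
      · refine tendsto_const_nhds.congr fun n => ?_
        have : s ∉ ⋃ i ∈ Finset.range n, f i := fun h' => by
          obtain ⟨i, _, hi⟩ := Set.mem_iUnion₂.1 h'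
          exact h (Set.mem_iUnion.2 ⟨i, hi⟩)
        rw [Set.indicator_of_notMem h, Set.indicator_of_notMem this]

/-- `g(A)` exists for every bounded measurable function `g` on the spectrum. -/
theorem exists_isBorelValue (hA : IsSelfAdjoint A) {g : spectrum ℝ A → ℝ}
    (hg : Measurable g) {M : ℝ} (hM : ∀ s, |g s| ≤ M) : ∃ T, IsBorelValue hA g T := by
  have hs : ∀ k : SimpleFunc (spectrum ℝ A) ℝ, ∃ T, IsBorelValue hA k T := by
    intro k
    induction k using SimpleFunc.induction with
    | const c hE =>
      rename_i E
      obtain ⟨T, hT⟩ := exists_isBorelValue_indicator hA hE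
      refine ⟨(c : ℂ) • T, ?_⟩
      convert hT.smul c using 2 with s
      rename_i s
      by_cases h : s ∈ E <;> simp [h]
    | add hdis hk hl =>
      rename_i k l
      obtain ⟨S, hS⟩ := hk
      obtain ⟨T, hT⟩ := hl
      exact ⟨_, hS.add hT (fun x => SimpleFunc.integrable_of_isFiniteMeasure k)
        (fun x => SimpleFunc.integrable_of_isFiniteMeasure l)⟩
  have hsm := hg.stronglyMeasurable
  by_cases hne : Nonempty (spectrum ℝ A)
  · have hM0 : 0 ≤ M := (abs_nonneg _).trans (hM hne.some)
    exact exists_isBorelValue_of_tendsto hA (fun n => (hsm.approxBounded M n).measurable)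
      (fun n s => hsm.norm_approxBounded_le hM0 n s)
      (fun s => hsm.tendsto_approxBounded_of_norm_le (hM s)) (fun n => hs _)
  · rw [not_nonempty_iff] at hne
    refine ⟨0, fun x => ?_⟩
    rw [(spectralMeasure hA x).eq_zero_of_isEmpty]
    simp

/-- The defining property of `g(A)` for `g` bounded and measurable on the spectrum of `A`. -/
theorem isBorelValue_borelCalculus (hA : IsSelfAdjoint A) {g : ℝ → ℝ}
    (hg : Measurable fun s : spectrum ℝ A => g s) {M : ℝ} (hM : ∀ s ∈ spectrum ℝ A, |g s| ≤ M) :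
    IsBorelValue hA (fun s => g s) (borelCalculus hA g) := by
  have h := exists_isBorelValue hA hg (fun s => hM s s.2)
  rw [borelCalculus, dif_pos h]
  exact h.choose_spec

/-- `c` is the slope of a supporting line at `s` of the function `f` on `J`:
`c (t - s) + f s ≤ f t` for all `t ∈ J`. -/
def IsSupportingSlope (f : ℝ → ℝ) (J : Set ℝ) (s c : ℝ) : Prop :=
  ∀ t ∈ J, c * (t - s) + f s ≤ f t

/-- A choice of supporting slopes is monotone, hence bounded and Borel measurable on the spectrum,
so that `C(A)` is given by the Borel functional calculus. -/
theorem isBorelValue_of_isSupportingSlope (hA : IsSelfAdjoint A) {f C : ℝ → ℝ} {J : Set ℝ}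
    (hJ : spectrum ℝ A ⊆ J) (hC : ∀ s ∈ spectrum ℝ A, IsSupportingSlope f J s (C s)) :
    IsBorelValue hA (fun s => C s) (borelCalculus hA C) := by
  have hmono : Monotone fun s : spectrum ℝ A => C s := by
    intro s t hst
    rcases hst.eq_or_lt with rfl | hlt
    · rfl
    have h1 := hC s s.2 t (hJ t.2)
    have h2 := hC t t.2 s (hJ s.2)
    have h3 : (s : ℝ) < t := hlt
    change C s ≤ C t
    nlinarith
  by_cases hne : Nonempty (spectrum ℝ A)
  · obtain ⟨a, _, ha⟩ := isCompact_univ.exists_isLeast (α := spectrum ℝ A) Set.univ_nonempty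
    obtain ⟨b, _, hb⟩ := isCompact_univ.exists_isGreatest (α := spectrum ℝ A) Set.univ_nonempty
    refine isBorelValue_borelCalculus hA hmono.measurable (M := max |C a| |C b|) fun s hs => ?_
    exact abs_le_max_abs_abs (hmono (ha (Set.mem_univ ⟨s, hs⟩)))
      (hmono (hb (Set.mem_univ ⟨s, hs⟩)))
  · exact isBorelValue_borelCalculus hA hmono.measurable (M := 0)
      fun s hs => (hne ⟨⟨s, hs⟩⟩).elim

end OperatorJensen

end

/-!
Write `B = ∑ i, Φ i (A i)`. Fix a unit vector `x` and put `t = ⟨B x, x⟩`. For `s` in the spectrum of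
`A i` the supporting line at `s`, evaluated at `t`, gives `f s ≤ f t + C s * s - t * C s`, hence
`f(A i) ≤ f t + C(A i) A i - t C(A i)` (`cfc_le_of_isSupportingSlope`). Applying `Φ i`, summing and
taking the quadratic form at `x` yields `⟨∑ i, Φ i (f(A i)) x, x⟩ ≤ f t + δ`. Finally
`f t ≤ ⟨f(B) x, x⟩` is Jensen's inequality for the vector state of `x` (`le_re_inner_cfc`), which
uses a supporting line at `t`.

Two points need care. The operator inequality involves the product of the Borel operator `C(A i)`
with `A i`, and it has to be known that this product is again given by the Borel calculus. The
scalar spectral measure at `(A + z) x` has density `|s + z|²` with respect to the one at `x`, and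
polarization turns this into `⟨C(A) A x, x⟩ = ∫ C s * s dμ_x` (`IsBorelValue.mul_self`).

The other point is the end points of `J`, where `f` may be discontinuous or have no supporting line.
They do not matter: let `[a, b]` be the smallest interval containing the spectra of all the `A i`.
Then `a` and `b` lie in the spectra, so slopes exist there by hypothesis, and all points strictly
between them are interior to `J`. So `f` has supporting lines throughout `[a, b]` and is Lipschitz
there (`continuousOn_Icc_of_isSupportingSlope`); and `a ≤ B ≤ b` by positivity of the `Φ i`.
-/

/-! ### Products in the Borel functional calculus -/

namespace OperatorJensen

open MeasureTheory

variable {H : Type*} [NormedAddCommGroup H] [InnerProductSpace ℂ H] [CompleteSpace H]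
  {A : H →L[ℂ] H}

/-- `⟨k(A) (A + z) x, (A + z) x⟩ = ∫ |s + z|² k(s) dμ_x` for continuous `k`. -/
lemma inner_cfcHom_apply_add_smul (hA : IsSelfAdjoint A) (x : H) (z : ℂ)
    (k : C(spectrum ℝ A, ℝ)) :
    inner ℂ (cfcHom (R := ℝ) hA k (A x + z • x)) (A x + z • x) =
      ((∫ s, ‖((s : ℝ) : ℂ) + z‖ ^ 2 * k s ∂spectralMeasure hA x : ℝ) : ℂ) := by
  let e : C(spectrum ℝ A, ℝ) := (ContinuousMap.id ℝ).restrict (spectrum ℝ A)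
  have he : cfcHom (R := ℝ) hA e = A := cfcHom_id hA
  set P := cfcHom (R := ℝ) hA k with hP
  have hcomm : A * P = P * A := by
    rw [← he, hP, ← map_mul, ← map_mul, mul_comm]
  have hApp : ∀ y, A (P y) = P (A y) := fun y => DFunLike.congr_fun hcomm y
  have hsym : ∀ u v : H, inner ℂ u (A v) = inner ℂ (A u) v := fun u v =>
    (hA.isSymmetric u v).symm
  have h1 := inner_cfcHom hA x (k * (e * e + (2 * z.re) • e + (‖z‖ ^ 2) • 1))
  have h2 : cfcHom (R := ℝ) hA (k * (e * e + (2 * z.re) • e + (‖z‖ ^ 2) • 1)) =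
      P * (A * A + (2 * z.re) • A + (‖z‖ ^ 2) • 1) := by
    rw [map_mul, map_add, map_add, map_mul, map_smul, map_smul, map_one, he]
  have h3 : (∫ s, (k * (e * e + (2 * z.re) • e + (‖z‖ ^ 2) • 1)) s
      ∂spectralMeasure hA x) = ∫ s, ‖((s : ℝ) : ℂ) + z‖ ^ 2 * k s ∂spectralMeasure hA x := by
    congr 1
    ext s
    have : e s = s := rfl
    simp only [ContinuousMap.mul_apply, ContinuousMap.add_apply, ContinuousMap.smul_apply, this,
      smul_eq_mul, ContinuousMap.one_apply, mul_one,
      ← Complex.normSq_eq_norm_sq, Complex.normSq_apply, Complex.add_re, Complex.add_im,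
      Complex.ofReal_re, Complex.ofReal_im]
    ring
  rw [← h3, ← h1, h2]
  have h4 : ((z.re : ℂ)) = (z + (starRingEnd ℂ) z) / 2 := by rw [Complex.add_conj]; push_cast; ring
  have h5 : ((‖z‖ : ℂ)) ^ 2 = (starRingEnd ℂ) z * z := (Complex.conj_mul' z).symm
  simp only [mul_apply_eq_comp, add_apply, smul_apply, map_add, map_smul,
    inner_add_left, inner_add_right, inner_smul_left, inner_smul_right, hsym, hApp,
    one_apply_eq_self, ← Complex.coe_smul,
    Complex.conj_ofReal]
  push_cast
  rw [h4, h5]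
  ring

/-- The scalar spectral measure at `(A + z) x` has density `s ↦ |s + z|²` with respect to the
one at `x`. -/
lemma spectralMeasure_apply_add_smul (hA : IsSelfAdjoint A) (x : H) (z : ℂ) :
    spectralMeasure hA (A x + z • x) = (spectralMeasure hA x).withDensity
      (fun s => ((‖((s : ℝ) : ℂ) + z‖₊ ^ 2 : NNReal) : ENNReal)) := by
  have hcont : Continuous fun s : spectrum ℝ A => ‖((s : ℝ) : ℂ) + z‖₊ ^ 2 := by fun_prop
  obtain ⟨M, hM⟩ := (isCompact_range hcont).bddAbove
  have : IsFiniteMeasure ((spectralMeasure hA x).withDensity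
      (fun s => ((‖((s : ℝ) : ℂ) + z‖₊ ^ 2 : NNReal) : ENNReal))) := by
    refine isFiniteMeasure_withDensity (ne_of_lt ?_)
    calc ∫⁻ s, ((‖((s : ℝ) : ℂ) + z‖₊ ^ 2 : NNReal) : ENNReal) ∂spectralMeasure hA x
        ≤ ∫⁻ s, (M : ENNReal) ∂spectralMeasure hA x :=
          lintegral_mono fun s => ENNReal.coe_le_coe.2 (hM ⟨s, rfl⟩)
      _ < ⊤ := by
          rw [lintegral_const]
          exact ENNReal.mul_lt_top ENNReal.coe_lt_top (measure_lt_top _ _)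
  refine ext_of_forall_integral_eq_of_IsFiniteMeasure fun k => ?_
  rw [integral_withDensity_eq_integral_smul hcont.measurable]
  have h1 := inner_cfcHom_apply_add_smul hA x z k.toContinuousMap
  rw [inner_cfcHom] at h1
  simpa [NNReal.smul_def] using Complex.ofReal_injective h1

/-- If `T = g(A)` in the sense of the Borel functional calculus, then `T A` is the value at `A` of
`s ↦ g s * s`. -/
theorem IsBorelValue.mul_self {hA : IsSelfAdjoint A} {g : spectrum ℝ A → ℝ} {T : H →L[ℂ] H}
    (hT : IsBorelValue hA g T) (hg : Measurable g) {M : ℝ} (hM : ∀ s, |g s| ≤ M) :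
    IsBorelValue hA (fun s => g s * s) (T * A) := by
  intro x
  have hz : ∀ z : ℂ, inner ℂ (T (A x + z • x)) (A x + z • x) =
      ((∫ s, ‖((s : ℝ) : ℂ) + z‖ ^ 2 * g s ∂spectralMeasure hA x : ℝ) : ℂ) := by
    intro z
    rw [hT, spectralMeasure_apply_add_smul,
      integral_withDensity_eq_integral_smul (by fun_prop)]
    simp [NNReal.smul_def]
  have hint : ∀ z : ℂ, Integrable (fun s : spectrum ℝ A => ‖((s : ℝ) : ℂ) + z‖ ^ 2 * g s)
      (spectralMeasure hA x) := by
    intro z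
    have hcont : Continuous fun s : spectrum ℝ A => ‖((s : ℝ) : ℂ) + z‖ ^ 2 := by fun_prop
    obtain ⟨N, hN⟩ := (isCompact_range hcont).bddAbove
    refine (integrable_of_bound hA x hg hM).bdd_mul hcont.aestronglyMeasurable (c := N)
      (Filter.Eventually.of_forall fun s => ?_)
    rw [Real.norm_of_nonneg (by positivity)]
    exact hN ⟨s, rfl⟩
  -- Polarization reduces `⟨T A x, x⟩` to the values of the quadratic form of `T` at `A x + z x`
  -- with `z = 1, -1, I, -I`.
  have hpol := inner_map_polarization' (T : H →ₗ[ℂ] H) (A x) x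
  have h1 := hz 1
  have h2 := hz (-1)
  have h3 := hz Complex.I
  have h4 := hz (-Complex.I)
  simp only [one_smul, neg_smul, ← sub_eq_add_neg] at h1 h2 h3 h4
  simp only [ContinuousLinearMap.coe_coe] at hpol
  rw [mul_apply_eq_comp, hpol, h1, h2, h3, h4]
  have h5 : (∫ s, ‖((s : ℝ) : ℂ) + Complex.I‖ ^ 2 * g s ∂spectralMeasure hA x) =
      ∫ s, ‖((s : ℝ) : ℂ) - Complex.I‖ ^ 2 * g s ∂spectralMeasure hA x := by
    congr 1
    ext s
    simp [← Complex.normSq_eq_norm_sq, Complex.normSq_apply]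
  have h6 : (∫ s, g s * s ∂spectralMeasure hA x) =
      ((∫ s, ‖((s : ℝ) : ℂ) + 1‖ ^ 2 * g s ∂spectralMeasure hA x) -
        ∫ s, ‖((s : ℝ) : ℂ) - 1‖ ^ 2 * g s ∂spectralMeasure hA x) / 4 := by
    rw [← integral_sub (hint 1) (by simpa [sub_eq_add_neg] using hint (-1)), ← integral_div]
    congr 1
    ext s
    simp only [← Complex.normSq_eq_norm_sq, Complex.normSq_apply, Complex.add_re, Complex.add_im,
      Complex.sub_re, Complex.sub_im, Complex.ofReal_re, Complex.ofReal_im, Complex.one_re,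
      Complex.one_im]
    ring
  rw [h5, h6]
  push_cast
  ring

lemma IsBorelValue.nonneg {hA : IsSelfAdjoint A} {g : spectrum ℝ A → ℝ} {T : H →L[ℂ] H}
    (hT : IsBorelValue hA g T) (hg : ∀ s, 0 ≤ g s) : 0 ≤ T := by
  rw [ContinuousLinearMap.nonneg_iff_isPositive, ContinuousLinearMap.isPositive_def]
  refine ⟨hT.isSymmetric, fun x => ?_⟩
  rw [ContinuousLinearMap.reApplyInnerSelf_apply, hT x]
  simpa using integral_nonneg hg

lemma isBorelValue_cfc (hA : IsSelfAdjoint A) {g : ℝ → ℝ} (hg : ContinuousOn g (spectrum ℝ A)) :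
    IsBorelValue hA (fun s => g s) (cfc g A) := by
  intro x
  rw [cfc_apply g A]
  exact inner_cfcHom hA x _

/-! ### Supporting slopes -/

/-- Supporting slopes are monotone in the point of support. -/
lemma IsSupportingSlope.le_of_lt {f : ℝ → ℝ} {J : Set ℝ} {s t c d : ℝ}
    (hs : IsSupportingSlope f J s c) (ht : IsSupportingSlope f J t d) (hsJ : s ∈ J) (htJ : t ∈ J)
    (hst : s < t) : c ≤ d := by
  have h1 := hs t htJ
  have h2 := ht s hsJ
  nlinarith

lemma exists_isSupportingSlope_of_mem_interior {f : ℝ → ℝ} {J : Set ℝ} (hf : ConvexOn ℝ J f)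
    {s : ℝ} (hs : s ∈ interior J) : ∃ c, IsSupportingSlope f J s c := by
  refine ⟨derivWithin f (Set.Ioi s) s, fun t ht => ?_⟩
  rcases lt_trichotomy t s with h | rfl | h
  · have h1 := (hf.slope_le_leftDeriv_of_mem_interior ht hs h).trans
      (hf.leftDeriv_le_rightDeriv_of_mem_interior hs)
    rw [slope_def_field, div_le_iff₀ (by linarith)] at h1
    linarith
  · simp
  · have h1 := hf.rightDeriv_le_slope_of_mem_interior hs ht h
    rw [slope_def_field, le_div_iff₀ (by linarith)] at h1
    linarith

lemma exists_isSupportingSlope_of_mem_Icc {f : ℝ → ℝ} {J : Set ℝ} (hf : ConvexOn ℝ J f)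
    {a b : ℝ} (ha : a ∈ J) (hb : b ∈ J) (hca : ∃ c, IsSupportingSlope f J a c)
    (hcb : ∃ c, IsSupportingSlope f J b c) {s : ℝ} (hs : s ∈ Set.Icc a b) :
    ∃ c, IsSupportingSlope f J s c := by
  rcases hs.1.eq_or_lt with rfl | h1
  · exact hca
  rcases hs.2.eq_or_lt with rfl | h2
  · exact hcb
  refine exists_isSupportingSlope_of_mem_interior hf (mem_interior.2 ⟨Set.Ioo a b, ?_, isOpen_Ioo,
    h1, h2⟩)
  exact Set.Ioo_subset_Icc_self.trans (hf.1.ordConnected.out ha hb)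

/-- A function with supporting slopes at all points of `[a, b]`, the ends included, is Lipschitz
there: all slopes lie between those at `a` and `b`. -/
lemma continuousOn_Icc_of_isSupportingSlope {f : ℝ → ℝ} {J : Set ℝ} {a b : ℝ}
    (hJ : Set.Icc a b ⊆ J) (hc : ∀ s ∈ Set.Icc a b, ∃ c, IsSupportingSlope f J s c) :
    ContinuousOn f (Set.Icc a b) := by
  rcases lt_or_ge b a with hab | hab
  · simp [Set.Icc_eq_empty hab.not_ge]
  obtain ⟨p, hp⟩ := hc a (Set.left_mem_Icc.2 hab)
  obtain ⟨q, hq⟩ := hc b (Set.right_mem_Icc.2 hab)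
  have hbound : ∀ s ∈ Set.Icc a b, ∃ c, IsSupportingSlope f J s c ∧ |c| ≤ max |p| |q| := by
    intro s hs
    rcases hs.1.eq_or_lt with rfl | h1
    · exact ⟨p, hp, le_max_left _ _⟩
    rcases hs.2.eq_or_lt with rfl | h2
    · exact ⟨q, hq, le_max_right _ _⟩
    obtain ⟨c, hc⟩ := hc s hs
    exact ⟨c, hc, abs_le_max_abs_abs
      (hp.le_of_lt hc (hJ (Set.left_mem_Icc.2 hab)) (hJ hs) h1)
      (hc.le_of_lt hq (hJ hs) (hJ (Set.right_mem_Icc.2 hab)) h2)⟩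
  have hle : ∀ s ∈ Set.Icc a b, ∀ t ∈ Set.Icc a b, f s ≤ f t + max |p| |q| * |s - t| := by
    intro s hs t ht
    obtain ⟨c, hc, hcb⟩ := hbound s hs
    have h1 := hc t (hJ ht)
    have h2 : c * (s - t) ≤ max |p| |q| * |s - t| :=
      (le_abs_self _).trans (abs_mul c _ ▸ mul_le_mul_of_nonneg_right hcb (abs_nonneg _))
    linarith
  refine LipschitzOnWith.continuousOn (K := (max |p| |q|).toNNReal)
    (LipschitzOnWith.of_le_add_mul _ fun s hs t ht => ?_)
  rw [Real.dist_eq, Real.coe_toNNReal _ ((abs_nonneg p).trans (le_max_left _ _))]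
  exact hle s hs t ht

/-! ### Operator inequalities -/

/-- The functional-calculus form of `f s ≤ f t + C s * (s - t)`. The product of `C(A)` and `A` is
the Borel value of `s ↦ C s * s` by `IsBorelValue.mul_self`, which makes the right-hand side
self-adjoint. -/
theorem cfc_le_of_isSupportingSlope (hA : IsSelfAdjoint A) {f C : ℝ → ℝ} {J : Set ℝ}
    (hJ : spectrum ℝ A ⊆ J) (hC : ∀ s ∈ spectrum ℝ A, IsSupportingSlope f J s (C s))
    (hf : ContinuousOn f (spectrum ℝ A)) {t : ℝ} (ht : t ∈ J) :
    cfc f A ≤ (f t : ℂ) • 1 + borelCalculus hA C * A - (t : ℂ) • borelCalculus hA C := by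
  have hmono : Monotone fun s : spectrum ℝ A => C s := by
    intro s u hsu
    rcases hsu.eq_or_lt with rfl | hlt
    · rfl
    · exact (hC s s.2).le_of_lt (hC u u.2) (hJ s.2) (hJ u.2) hlt
  obtain ⟨M, hM⟩ : ∃ M, ∀ s : spectrum ℝ A, |C s| ≤ M := by
    rcases isEmpty_or_nonempty (spectrum ℝ A) with he | hne
    · exact ⟨0, fun s => he.elim s⟩
    obtain ⟨a, _, ha⟩ := isCompact_univ.exists_isLeast (α := spectrum ℝ A) Set.univ_nonempty
    obtain ⟨b, _, hb⟩ := isCompact_univ.exists_isGreatest (α := spectrum ℝ A) Set.univ_nonempty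
    exact ⟨max |C a| |C b|, fun s => abs_le_max_abs_abs (hmono (ha (Set.mem_univ s)))
      (hmono (hb (Set.mem_univ s)))⟩
  have hCT := isBorelValue_of_isSupportingSlope hA hJ hC
  have hCA := hCT.mul_self hmono.measurable hM
  have hfA := isBorelValue_cfc hA hf
  have h1 : IsBorelValue hA (fun _ => (1 : ℝ)) 1 := by
    simpa only [cfc_const_one ℝ A] using
      isBorelValue_cfc hA (g := fun _ => (1 : ℝ)) continuousOn_const
  have iC : ∀ x, Integrable (fun s : spectrum ℝ A => C s) (spectralMeasure hA x) := fun x =>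
    integrable_of_bound hA x hmono.measurable hM
  have iof : ∀ {k : spectrum ℝ A → ℝ}, Continuous k → ∀ x, Integrable k (spectralMeasure hA x) :=
    fun hk x => hk.integrable_of_hasCompactSupport (HasCompactSupport.of_compactSpace _)
  have iCs : ∀ x, Integrable (fun s : spectrum ℝ A => C s * s) (spectralMeasure hA x) := by
    intro x
    obtain ⟨N, hN⟩ := (isCompact_range
      (show Continuous fun s : spectrum ℝ A => |(s : ℝ)| by fun_prop)).bddAbove
    exact (iC x).mul_bdd (c := N) (by fun_prop)
      (Filter.Eventually.of_forall fun s => hN ⟨s, rfl⟩)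
  -- The difference of the two sides is the Borel value of the nonnegative function
  -- `s ↦ f t + C s * s - t * C s - f s`.
  have i1 := iof (continuous_const (y := (1 : ℝ)))
  have if' := iof hf.domRestrict
  have key := (((h1.smul (f t)).add hCA (fun x => (i1 x).const_mul _) iCs).add (hCT.smul (-t))
    (fun x => ((i1 x).const_mul _).add (iCs x)) (fun x => (iC x).const_mul _)).add
    (hfA.smul (-1)) (fun x => (((i1 x).const_mul _).add (iCs x)).add ((iC x).const_mul _))
    (fun x => (if' x).const_mul _)
  rw [← sub_nonneg]
  convert key.nonneg fun s => ?_ using 1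
  · push_cast
    module
  · have := hC s s.2 t ht
    linarith

lemma le_of_forall_norm_eq_one {X Y : H →L[ℂ] H} (hX : IsSelfAdjoint X) (hY : IsSelfAdjoint Y)
    (h : ∀ x : H, ‖x‖ = 1 → (inner ℂ (X x) x).re ≤ (inner ℂ (Y x) x).re) : X ≤ Y := by
  rw [ContinuousLinearMap.le_def, ContinuousLinearMap.isPositive_def]
  refine ⟨(hY.sub hX).isSymmetric, fun x => ?_⟩
  rw [ContinuousLinearMap.reApplyInnerSelf_apply]
  rcases eq_or_ne x 0 with rfl | hx
  · simp
  have hn : 0 < ‖x‖ := norm_pos_iff.2 hx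
  have h1 := h (((‖x‖⁻¹ : ℝ) : ℂ) • x) (by
    rw [norm_smul, Complex.norm_real, norm_inv, norm_norm, inv_mul_cancel₀ hn.ne'])
  simp only [map_smul, inner_smul_left, inner_smul_right, Complex.conj_ofReal, ← mul_assoc,
    ← Complex.ofReal_mul, Complex.re_ofReal_mul] at h1
  have h2 := le_of_mul_le_mul_left h1 (by positivity)
  simpa [inner_sub_left] using h2

lemma re_inner_le_of_le {E : Type*} [NormedAddCommGroup E] [InnerProductSpace ℂ E]
    {X Y : E →L[ℂ] E} (h : X ≤ Y) (x : E) :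
    (inner ℂ (X x) x).re ≤ (inner ℂ (Y x) x).re := by
  have h1 := ((ContinuousLinearMap.isPositive_def.1 ((ContinuousLinearMap.le_def _ _).1 h)).2 x)
  rw [ContinuousLinearMap.reApplyInnerSelf_apply] at h1
  simpa [inner_sub_left] using h1

lemma re_inner_smul_one {E : Type*} [NormedAddCommGroup E] [InnerProductSpace ℂ E]
    {x : E} (hx : ‖x‖ = 1) (r : ℝ) :
    (inner ℂ (((r : ℂ) • (1 : E →L[ℂ] E)) x) x).re = r := by
  rw [smul_apply, one_apply_eq_self, inner_smul_left, inner_self_eq_norm_sq_to_K, hx]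
  simp

lemma abs_re_inner_le {E : Type*} [NormedAddCommGroup E] [InnerProductSpace ℂ E]
    {x : E} (hx : ‖x‖ = 1) (T : E →L[ℂ] E) : |(inner ℂ (T x) x).re| ≤ ‖T‖ :=
  calc |(inner ℂ (T x) x).re| ≤ ‖T x‖ * ‖x‖ :=
        (Complex.abs_re_le_norm _).trans (norm_inner_le_norm _ _)
    _ ≤ ‖T‖ := by simpa [hx] using T.le_opNorm x

/-- Jensen's inequality for a unit vector, at a point where `f` has a supporting line. -/
lemma le_re_inner_cfc (hA : IsSelfAdjoint A) {f : ℝ → ℝ} {J : Set ℝ} (hJ : spectrum ℝ A ⊆ J)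
    (hf : ContinuousOn f (spectrum ℝ A)) {x : H} (hx : ‖x‖ = 1) {c : ℝ}
    (hc : IsSupportingSlope f J (inner ℂ (A x) x).re c) :
    f (inner ℂ (A x) x).re ≤ (inner ℂ (cfc f A x) x).re := by
  set t := (inner ℂ (A x) x).re with ht
  have h1 : cfc (fun s => c * s + (f t - c * t)) A ≤ cfc f A :=
    cfc_mono (fun s hs => by have := hc s (hJ hs); linarith)
  have h2 : cfc (fun s => c * s + (f t - c * t)) A =
      (c : ℂ) • A + ((f t - c * t : ℝ) : ℂ) • 1 := by
    rw [cfc_add_const (f t - c * t) (fun s => c * s) A, cfc_const_mul_id c A,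
      Algebra.algebraMap_eq_smul_one, Complex.coe_smul, Complex.coe_smul]
  rw [h2] at h1
  have h3 := re_inner_le_of_le h1 x
  rw [add_apply, inner_add_left, Complex.add_re, re_inner_smul_one hx, smul_apply,
    inner_smul_left, Complex.conj_ofReal, Complex.re_ofReal_mul, ← ht] at h3
  linarith

/-! ### Sums of positive maps and the Jensen inequality -/

lemma sum_map_le_algebraMap {G K ι : Type*} [NormedAddCommGroup G]
    [InnerProductSpace ℂ G] [NormedAddCommGroup K] [InnerProductSpace ℂ K] [CompleteSpace K]
    [Fintype ι]
    {Φ : ι → (G →L[ℂ] G) →ₚ[ℂ] (K →L[ℂ] K)} (hΦ : ∑ i, Φ i 1 = 1)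
    {A : ι → G →L[ℂ] G} {b : ℝ} (h : ∀ i, A i ≤ algebraMap ℝ _ b) :
    ∑ i, Φ i (A i) ≤ algebraMap ℝ _ b := by
  calc ∑ i, Φ i (A i) ≤ ∑ i, Φ i (algebraMap ℝ _ b) :=
        Finset.sum_le_sum fun i _ => OrderHomClass.mono (Φ i) (h i)
    _ = algebraMap ℝ _ b := by
        simp_rw [Algebra.algebraMap_eq_smul_one, ← Complex.coe_smul, map_smul, ← Finset.smul_sum,
          hΦ]

lemma algebraMap_le_sum_map {G K ι : Type*} [NormedAddCommGroup G]
    [InnerProductSpace ℂ G] [NormedAddCommGroup K] [InnerProductSpace ℂ K] [CompleteSpace K]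
    [Fintype ι]
    {Φ : ι → (G →L[ℂ] G) →ₚ[ℂ] (K →L[ℂ] K)} (hΦ : ∑ i, Φ i 1 = 1)
    {A : ι → G →L[ℂ] G} {a : ℝ} (h : ∀ i, algebraMap ℝ _ a ≤ A i) :
    algebraMap ℝ _ a ≤ ∑ i, Φ i (A i) := by
  calc algebraMap ℝ _ a = ∑ i, Φ i (algebraMap ℝ _ a) := by
        simp_rw [Algebra.algebraMap_eq_smul_one, ← Complex.coe_smul, map_smul, ← Finset.smul_sum,
          hΦ]
    _ ≤ ∑ i, Φ i (A i) := Finset.sum_le_sum fun i _ => OrderHomClass.mono (Φ i) (h i)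

/-- The smallest interval containing all the spectra has its end points in the spectra, so that
`f` has supporting slopes at these points by hypothesis, even if they are end points of `J`. -/
lemma exists_Icc_spectrum {ι : Type*} [Finite ι] [Nontrivial H] [Nonempty ι]
    {A : ι → H →L[ℂ] H} (hA : ∀ i, IsSelfAdjoint (A i)) :
    ∃ a b, (∃ i, a ∈ spectrum ℝ (A i)) ∧ (∃ i, b ∈ spectrum ℝ (A i)) ∧
      ∀ i, spectrum ℝ (A i) ⊆ Set.Icc a b := by
  have hcpt : IsCompact (⋃ i, spectrum ℝ (A i)) :=
    isCompact_iUnion fun i => spectrum.isCompact (A i)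
  have hne : (⋃ i, spectrum ℝ (A i)).Nonempty := by
    obtain ⟨i⟩ := ‹Nonempty ι›
    exact (ContinuousFunctionalCalculus.spectrum_nonempty (A i) (hA i)).mono
      (Set.subset_iUnion (fun i => spectrum ℝ (A i)) i)
  obtain ⟨a, ha, ha'⟩ := hcpt.exists_isLeast hne
  obtain ⟨b, hb, hb'⟩ := hcpt.exists_isGreatest hne
  exact ⟨a, b, Set.mem_iUnion.1 ha, Set.mem_iUnion.1 hb, fun i s hs =>
    ⟨ha' (Set.mem_iUnion.2 ⟨i, hs⟩), hb' (Set.mem_iUnion.2 ⟨i, hs⟩)⟩⟩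

end OperatorJensen

open OperatorJensen in
theorem theorem2p1
    {H : Type*} [NormedAddCommGroup H] [InnerProductSpace ℂ H] [CompleteSpace H]
    {K : Type*} [NormedAddCommGroup K] [InnerProductSpace ℂ K] [CompleteSpace K]
    (J : Set ℝ) (hJ : J.OrdConnected) (f : ℝ → ℝ) (hf : ConvexOn ℝ J f)
    (hmono : MonotoneOn f J ∨ AntitoneOn f J)
    (n : ℕ) (A : Fin n → H →L[ℂ] H) (hA : ∀ i, IsSelfAdjoint (A i))
    (hspec : ∀ i, spectrum ℝ (A i) ⊆ J)
    (Φ : Fin n → (H →L[ℂ] H) →ₚ[ℂ] (K →L[ℂ] K)) (hΦ : ∑ i, Φ i 1 = 1)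
    (C : ℝ → ℝ)
    (hC : ∀ i, ∀ s ∈ spectrum ℝ (A i), OperatorJensen.IsSupportingSlope f J s (C s))
    (S : Set ℝ)
    (hS : S = {r : ℝ | ∃ x : K, ‖x‖ = 1 ∧
      r = (inner ℂ ((∑ i, Φ i (OperatorJensen.borelCalculus (hA i) C * A i)) x) x).re -
        (inner ℂ ((∑ i, Φ i (A i)) x) x).re *
          (inner ℂ ((∑ i, Φ i (OperatorJensen.borelCalculus (hA i) C)) x) x).re}) :
    -- all operators and the supremum in the inequality are well defined
    (∀ i, ContinuousOn f (spectrum ℝ (A i))) ∧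
    spectrum ℝ (∑ i, Φ i (A i)) ⊆ J ∧
    ContinuousOn f (spectrum ℝ (∑ i, Φ i (A i))) ∧
    BddAbove S ∧
    -- the inequality, with `δ = sSup S`
    ∑ i, Φ i (cfc f (A i)) ≤ cfc f (∑ i, Φ i (A i)) + ((sSup S : ℝ) : ℂ) • (1 : K →L[ℂ] K) := by
  have hbdd : BddAbove S := by
    refine ⟨‖∑ i, Φ i (borelCalculus (hA i) C * A i)‖ +
      ‖∑ i, Φ i (A i)‖ * ‖∑ i, Φ i (borelCalculus (hA i) C)‖, ?_⟩
    rw [hS]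
    rintro _ ⟨x, hx, rfl⟩
    have h1 := abs_re_inner_le hx (∑ i, Φ i (borelCalculus (hA i) C * A i))
    have h2 := mul_le_mul (abs_re_inner_le hx (∑ i, Φ i (A i)))
      (abs_re_inner_le hx (∑ i, Φ i (borelCalculus (hA i) C))) (abs_nonneg _) (norm_nonneg _)
    rw [← abs_mul] at h2
    linarith [(abs_le.1 h1).2, (abs_le.1 h2).1]
  by_cases htriv : Nontrivial H ∧ Nonempty (Fin n)
  · obtain ⟨_, _⟩ := htriv
    obtain ⟨a, b, ⟨i, ha⟩, ⟨j, hb⟩, hab⟩ := exists_Icc_spectrum hA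
    have hIcc : Set.Icc a b ⊆ J := hJ.out (hspec i ha) (hspec j hb)
    have hslope : ∀ s ∈ Set.Icc a b, ∃ c, IsSupportingSlope f J s c := fun s hs =>
      exists_isSupportingSlope_of_mem_Icc hf (hspec i ha) (hspec j hb) ⟨_, hC i a ha⟩
        ⟨_, hC j b hb⟩ hs
    have hcont : ContinuousOn f (Set.Icc a b) := continuousOn_Icc_of_isSupportingSlope hIcc hslope
    set B := ∑ i, Φ i (A i) with hB
    have hBsa : IsSelfAdjoint B := isSelfAdjoint_sum _ fun i _ => (hA i).map (Φ i)
    have haB : algebraMap ℝ _ a ≤ B := algebraMap_le_sum_map hΦ fun i =>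
      (algebraMap_le_iff_le_spectrum (hA i)).2 fun s hs => (hab i hs).1
    have hBb : B ≤ algebraMap ℝ _ b := sum_map_le_algebraMap hΦ fun i =>
      (le_algebraMap_iff_spectrum_le (hA i)).2 fun s hs => (hab i hs).2
    have hBspec : spectrum ℝ B ⊆ Set.Icc a b := fun s hs =>
      ⟨(algebraMap_le_iff_le_spectrum hBsa).1 haB s hs,
        (le_algebraMap_iff_spectrum_le hBsa).1 hBb s hs⟩
    refine ⟨fun i => hcont.mono (hab i), hBspec.trans hIcc, hcont.mono hBspec, hbdd, ?_⟩
    refine le_of_forall_norm_eq_one (isSelfAdjoint_sum _ fun i _ => (cfc_predicate f (A i)).map _)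
      ((cfc_predicate f B).add (IsSelfAdjoint.smul (Complex.conj_ofReal _) (.one _)))
      fun x hx => ?_
    -- The supporting-line inequality is used at the point `t = ⟨B x, x⟩`, which depends on `x`.
    set t := (inner ℂ (B x) x).re with ht
    have htab : t ∈ Set.Icc a b := by
      rw [Algebra.algebraMap_eq_smul_one, ← Complex.coe_smul] at haB hBb
      have h1 := re_inner_le_of_le haB x
      have h2 := re_inner_le_of_le hBb x
      rw [re_inner_smul_one hx] at h1 h2
      exact ⟨h1, h2⟩
    obtain ⟨c, hc⟩ := hslope t htab
    have hJensen := le_re_inner_cfc hBsa (hBspec.trans hIcc) (hcont.mono hBspec) hx hc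
    have hδ : (inner ℂ ((∑ i, Φ i (borelCalculus (hA i) C * A i)) x) x).re -
        t * (inner ℂ ((∑ i, Φ i (borelCalculus (hA i) C)) x) x).re ≤ sSup S :=
      le_csSup hbdd (by rw [hS]; exact ⟨x, hx, rfl⟩)
    have hsum : ∑ i, Φ i (cfc f (A i)) ≤ (f t : ℂ) • 1 +
        ∑ i, Φ i (borelCalculus (hA i) C * A i) -
          (t : ℂ) • ∑ i, Φ i (borelCalculus (hA i) C) := by
      calc ∑ i, Φ i (cfc f (A i))
          ≤ ∑ i, Φ i ((f t : ℂ) • 1 + borelCalculus (hA i) C * A i -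
              (t : ℂ) • borelCalculus (hA i) C) :=
            Finset.sum_le_sum fun i _ => OrderHomClass.mono (Φ i)
              (cfc_le_of_isSupportingSlope (hA i) (hspec i) (hC i) (hcont.mono (hab i))
                (hIcc htab))
        _ = _ := by
            simp only [map_sub, map_add, map_smul, Finset.sum_sub_distrib, Finset.sum_add_distrib,
              ← Finset.smul_sum, hΦ]
    have h1 := re_inner_le_of_le hsum x
    rw [sub_apply, add_apply, inner_sub_left, inner_add_left, Complex.sub_re,
      Complex.add_re, re_inner_smul_one hx, smul_apply, inner_smul_left, Complex.conj_ofReal,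
      Complex.re_ofReal_mul] at h1
    rw [add_apply, inner_add_left, Complex.add_re, re_inner_smul_one hx]
    linarith
  -- If `H = 0` or `n = 0`, then `1 = ∑ i, Φ i 1 = 0`, so that `K = 0` too.
  · have h1 : (1 : K →L[ℂ] K) = 0 := by
      rw [← hΦ]
      refine Finset.sum_eq_zero fun i _ => ?_
      have : Subsingleton H := not_nontrivial_iff_subsingleton.1 fun h => htriv ⟨h, ⟨i⟩⟩
      rw [Subsingleton.elim (1 : H →L[ℂ] H) 0, map_zero]
    have : Subsingleton (K →L[ℂ] K) := subsingleton_of_zero_eq_one h1.symm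
    refine ⟨fun i => ?_, ?_, ?_, hbdd, (Subsingleton.elim _ _).le⟩
    · have : Subsingleton H := not_nontrivial_iff_subsingleton.1 fun h => htriv ⟨h, ⟨i⟩⟩
      simp [spectrum.of_subsingleton]
    · simp [spectrum.of_subsingleton]
    · simp [spectrum.of_subsingleton]
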